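/- Let $\mathcal E=\{p_x,\rho_x\}_{x\in A}$ be an ensemble: $p$ is a probability distribution on a finite alphabet $A$ and the $\rho_x$ are density operators on a finite-dimensional Hilbert space $\mathcal H_B$. Put $\rho=\sum_x p_x\rho_x$, $H(p)=-\sum_x p_x\log_2 p_x$, $S(\sigma)=-\mathrm{Tr}\,\sigma\log_2\sigma$, $\bar S=\sum_x p_xS(\rho_x)$ and $\chi(\mathcal E)=S(\rho)-\bar S$. For $\mathbf x=(x_1,\dots,x_n)\in A^n$ let $p_{\mathbf x}=p_{x_1}\cdots p_{x_n}$ and $\rho_{\mathbf x}=\rho_{x_1}\otimes\cdots\otimes\rho_{x_n}$. Fix $\delta>0$. Call $\mathbf x\in A^n$ typical if $2^{-n[H(p)+\delta]}\le p_{\mathbf x}\le 2^{-n[H(p)-\delta]}$. Let $\Pi$ be the projection onto the span of the eigenvectors of $\rho^{\otimes n}$ with eigenvalue in $[2^{-n[S(\rho)+\delta]},2^{-n[S(\rho)-\delta]}]$, and $\Pi_{\mathbf x}$ the projection onto the span of the eigenvectors of $\rho_{\mathbf x}$ with eigenvalue in $[2^{-n[\bar S+\delta]},2^{-n[\bar S-\delta]}]$.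 Put $\Lambda_{\mathbf x}=\Pi\,\Pi_{\mathbf x}\,\Pi$ if $\mathbf x$ is typical and $\Lambda_{\mathbf x}=0$ otherwise. For $f:A^n\to\mathcal Y$ let $$E^f_{\mathbf y}=T^{-1/2}\Lambda_{\mathbf y}T^{-1/2},\qquad T=\sum_{\mathbf y':\,f(\mathbf y')=f(\mathbf y)}\Lambda_{\mathbf y'},$$ where $T^{-1/2}$ is the inverse square root on the support of $T$ and $0$ on its kernel. Alice announces $f(\mathbf x)$ and Bob applies the measurement $\{E^f_{\mathbf y}: f(\mathbf y)=f(\mathbf x)\}$ to $\rho_{\mathbf x}$, so the average error probability is $P_{E|f}=\sum_{\mathbf x}p_{\mathbf x}\mathrm{Tr}[\rho_{\mathbf x}(1-E^f_{\mathbf x})]$. For a random $f$ write $P_E$ for the expectation of $P_{E|f}$ over $f$. A random function $f:A^n\to\mathcal Y$ (a finite family of functions with a probability distribution on it, $\mathcal Y$ finite) is 2-universal if $\Pr[f(\mathbf x)=f(\mathbf x')]\le 1/|\mathcal Y|$ for all $\mathbf x\ne\mathbf x'$. Then: 1. For all $n$, all $f:A^n\to\mathcal Y$ and all $h\in\mathcal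 Y$, the operators $E^f_{\mathbf y}$ are positive semidefinite and $\sum_{\mathbf y:\,f(\mathbf y)=h}E^f_{\mathbf y}\le 1$. 2. For every $\varepsilon>0$ there is $N$ (depending only on $\mathcal E,\delta,\varepsilon$) such that for all $n\ge N$, all finite $\mathcal Y$ and all 2-universal random functions $f:A^n\to\mathcal Y$, $$P_E\le 8\varepsilon+\frac{4\cdot 2^{n[H(p)-\chi(\mathcal E)+3\delta]}}{|\mathcal Y|}.$$ 3. If for each $n$ a 2-universal random function $f_n:A^n\to\mathcal Y_n$ with $\log_2|\mathcal Y_n|\ge n[H(p)-\chi(\mathcal E)+4\delta]$ is used, then $P_E\to0$ as $n\to\infty$. -/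

import Mathlib

open scoped BigOperators ComplexOrder

noncomputable section

namespace HolevoHash

/-- A source ensemble `{p_x, ρ_x}`: a probability distribution on a finite alphabet `A` together
with density matrices on the finite-dimensional Hilbert space `ℂ^B`. -/
structure Ensemble (A B : Type*) [Fintype A] [Fintype B] where
  /-- the letter probabilities -/
  p : A → ℝ
  /-- the states given to Bob -/
  ρ : A → Matrix B B ℂ
  p_nonneg : ∀ a, 0 ≤ p a
  p_sum : ∑ a, p a = 1
  ρ_posSemidef : ∀ a, (ρ a).PosSemidef
  ρ_trace : ∀ a, (ρ a).trace = 1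

/-- Von Neumann entropy (in bits) `-Tr (M log₂ M)`, with `0 log₂ 0 = 0`. -/
def vonNeumannEntropy {C : Type*} [Fintype C] [DecidableEq C] (M : Matrix C C ℂ) : ℝ :=
  -((cfc (fun t : ℝ => t * Real.logb 2 t) M).trace).re

/-- The projection onto the span of the eigenvectors of the Hermitian matrix `M` whose
eigenvalues lie in `[a, b]`. -/
def spectralProj {C : Type*} [Fintype C] [DecidableEq C] (M : Matrix C C ℂ) (a b : ℝ) :
    Matrix C C ℂ :=
  cfc (Set.indicator (Set.Icc a b) (fun _ : ℝ => (1 : ℝ))) M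

/-- The inverse square root of a positive semidefinite matrix on its support (and `0` on its
kernel, since `(√0)⁻¹ = 0`). -/
def invSqrt {C : Type*} [Fintype C] [DecidableEq C] (M : Matrix C C ℂ) : Matrix C C ℂ :=
  cfc (fun t : ℝ => (Real.sqrt t)⁻¹) M

/-- The tensor product `M_1 ⊗ ⋯ ⊗ M_n` as a matrix indexed by length-`n` words. -/
def tensor {B : Type*} {n : ℕ} (M : Fin n → Matrix B B ℂ) :
    Matrix (Fin n → B) (Fin n → B) ℂ :=
  Matrix.of fun b b' => ∏ i, M i (b i) (b' i)

namespace Ensemble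

variable {A B : Type*} [Fintype A] [Fintype B] [DecidableEq B]

/-- Shannon entropy `H(p)` in bits. -/
def H (E : Ensemble A B) : ℝ := -∑ a, E.p a * Real.logb 2 (E.p a)

/-- The average state `ρ = ∑ p_x ρ_x`. -/
def avg (E : Ensemble A B) : Matrix B B ℂ := ∑ a, (E.p a : ℂ) • E.ρ a

/-- The average entropy `∑ p_x S(ρ_x)`. -/
def condEntropy (E : Ensemble A B) : ℝ := ∑ a, E.p a * vonNeumannEntropy (E.ρ a)

/-- The Holevo quantity `χ = S(ρ) - ∑ p_x S(ρ_x)`. -/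
def χ (E : Ensemble A B) : ℝ := vonNeumannEntropy E.avg - E.condEntropy

/-- The probability `p_{x_1} ⋯ p_{x_n}` of a block. -/
def blockProb (E : Ensemble A B) {n : ℕ} (x : Fin n → A) : ℝ := ∏ i, E.p (x i)

/-- The state `ρ_{x_1} ⊗ ⋯ ⊗ ρ_{x_n}` of a block. -/
def blockState (E : Ensemble A B) {n : ℕ} (x : Fin n → A) :
    Matrix (Fin n → B) (Fin n → B) ℂ :=
  tensor fun i => E.ρ (x i)

/-- A block is `δ`-typical if its probability is within a factor `2^{± n δ}` of its likely value
`2^{-n H(p)}`. -/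
def IsTypical (E : Ensemble A B) (δ : ℝ) {n : ℕ} (x : Fin n → A) : Prop :=
  E.blockProb x ∈ Set.Icc ((2 : ℝ) ^ (-(n : ℝ) * (E.H + δ))) ((2 : ℝ) ^ (-(n : ℝ) * (E.H - δ)))

/-- The projection `Π` onto the `δ`-typical subspace of `ρ^{⊗ n}`: eigenvalues within a factor
`2^{± n δ}` of the likely value `2^{-n S(ρ)}`. -/
def typProj (E : Ensemble A B) (δ : ℝ) (n : ℕ) : Matrix (Fin n → B) (Fin n → B) ℂ :=
  spectralProj (tensor fun _ : Fin n => E.avg)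
    ((2 : ℝ) ^ (-(n : ℝ) * (vonNeumannEntropy E.avg + δ)))
    ((2 : ℝ) ^ (-(n : ℝ) * (vonNeumannEntropy E.avg - δ)))

/-- The projection `Π_x` onto the `δ`-typical subspace of `ρ_x`: eigenvalues within a factor
`2^{± n δ}` of the likely value `2^{-n ∑ p_j S(ρ_j)}`. -/
def condTypProj (E : Ensemble A B) (δ : ℝ) {n : ℕ} (x : Fin n → A) :
    Matrix (Fin n → B) (Fin n → B) ℂ :=
  spectralProj (E.blockState x)
    ((2 : ℝ) ^ (-(n : ℝ) * (E.condEntropy + δ)))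
    ((2 : ℝ) ^ (-(n : ℝ) * (E.condEntropy - δ)))

open Classical in
/-- `Λ_x = Π Π_x Π` for typical `x`, and `0` for nontypical `x`. -/
def Λ (E : Ensemble A B) (δ : ℝ) {n : ℕ} (x : Fin n → A) :
    Matrix (Fin n → B) (Fin n → B) ℂ :=
  if E.IsTypical δ x then E.typProj δ n * E.condTypProj δ x * E.typProj δ n else 0

/-- `T = ∑ Λ_y` over all blocks `y` with hash value `f y = h`. -/
def T (E : Ensemble A B) (δ : ℝ) {n : ℕ} {Y : Type*} [DecidableEq Y]
    (f : (Fin n → A) → Y) (h : Y) : Matrix (Fin n → B) (Fin n → B) ℂ :=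
  ∑ y with f y = h, E.Λ δ y

/-- The element `E_y^f = T^{-1/2} Λ_y T^{-1/2}` of Bob's pretty good measurement, used when the
announced hash value is `f y`. -/
def povm (E : Ensemble A B) (δ : ℝ) {n : ℕ} {Y : Type*} [DecidableEq Y]
    (f : (Fin n → A) → Y) (y : Fin n → A) : Matrix (Fin n → B) (Fin n → B) ℂ :=
  invSqrt (E.T δ f (f y)) * E.Λ δ y * invSqrt (E.T δ f (f y))

/-- The error probability `∑ p_x Tr[ρ_x (1 - E_x^f)]` for a given hash function `f`. -/
def errorGiven (E : Ensemble A B) (δ : ℝ) {n : ℕ} {Y : Type*} [DecidableEq Y]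
    (f : (Fin n → A) → Y) : ℝ :=
  ∑ x, E.blockProb x * ((E.blockState x * (1 - E.povm δ f x)).trace).re

end Ensemble

/-- A random function `X → Y`: a finite family of functions indexed by seeds `k : K`, with a
probability distribution on the seeds. -/
structure RandomHash (X Y K : Type*) [Fintype K] where
  /-- the functions of the family -/
  f : K → X → Y
  /-- the probability of each seed -/
  q : K → ℝ
  q_nonneg : ∀ k, 0 ≤ q k
  q_sum : ∑ k, q k = 1

/-- 2-universality: `Pr[f(x) = f(x')] ≤ 1 / |Y|` for all `x ≠ x'`. -/
def RandomHash.IsTwoUniversal {X Y K : Type*} [Fintype K] [Fintype Y] [DecidableEq Y]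
    (F : RandomHash X Y K) : Prop :=
  ∀ x x' : X, x ≠ x' → ∑ k with F.f k x = F.f k x', F.q k ≤ 1 / (Fintype.card Y : ℝ)

/-- The error probability averaged over the random hash function. -/
def avgError {A B : Type*} [Fintype A] [Fintype B] [DecidableEq B] (E : Ensemble A B) (δ : ℝ)
    {n : ℕ} {Y K : Type*} [Fintype K] [DecidableEq Y] (F : RandomHash (Fin n → A) Y K) : ℝ :=
  ∑ k, F.q k * E.errorGiven δ (F.f k)

end HolevoHash

end

/-!
For positive semidefinite `S ≤ 1` and `T`, the Hayashi–Nagaoka inequality bounds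
`1 - (S + T)^{-1/2} S (S + T)^{-1/2}` by `2 (1 - S) + 4 T`. With `S = Λ_x` and `T` the sum of the
other `Λ_y` having the same hash value as `x`, it splits the error of the measurement `E^f` into
the probability that `Λ_x` misses `ρ_x` and the probability that some colliding `Λ_y` responds to
`ρ_x`.

Averaged over a 2-universal hash function, each `y ≠ x` collides with `x` with probability at most
`1 / |Y|`, so the second term is at most `4 / |Y|` times `∑ y, Tr (ρ^{⊗n} Λ_y)`. On the ranges of
`Π` and `Π_y` the eigenvalues of `ρ^{⊗n}` and `ρ_y` are at most `2^{-n (S(ρ) - δ)}` and at least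
`2^{-n (∑ a, p_a S(ρ_a) + δ)}`; hence each summand is at most `2^{-n (χ - 2 δ)}`, which typicality
of `y` bounds by `p_y 2^{n (H - χ + 3 δ)}`.

The first term tends to zero by Chebyshev's inequality, used for three i.i.d. sources: the letters
`x_i`, the eigenvalues of `ρ`, and the pairs of a letter `a` and an eigenvalue of `ρ_a`.
-/

namespace HolevoHash

open scoped MatrixOrder

section StarOrderedRing

variable {R : Type*} [Ring R] [PartialOrder R] [StarRing R] [StarOrderedRing R]

theorem one_sub_conj_le {p q : R} (hp : IsStarProjection p) (hq₀ : 0 ≤ q) (hq₁ : q ≤ 1) :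
    1 - p * q * p ≤ 3 • (1 - p) + 2 • (1 - q) := by
  have hsa : IsSelfAdjoint (1 - p) := hp.one_sub.isSelfAdjoint
  have hpp : p * p = p := hp.isIdempotentElem
  have key : 3 • (1 - p) + 2 • (1 - q) - (1 - p * q * p) =
      (1 + (1 - p)) * (1 - q) * (1 + (1 - p)) + 2 • ((1 - p) * q * (1 - p)) + (p - p * p) := by
    noncomm_ring
  rw [← sub_nonneg, key, hpp, sub_self, add_zero]
  exact add_nonneg (((IsSelfAdjoint.one R).add hsa).conjugate_nonneg (sub_nonneg.mpr hq₁))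
    (nsmul_nonneg (hsa.conjugate_nonneg hq₀) 2)

/-- The algebraic core of the Hayashi–Nagaoka inequality, where `r` plays the role of
`(s + t)^{-1/2}` and `x` that of `(s + t)^{1/2}`. -/
theorem one_sub_conj_le_of_mul_eq {r s t x : R} (hr : IsSelfAdjoint r) (hs : 0 ≤ s) (ht : 0 ≤ t)
    (hrx : r * (s + t) = x) (hxr : (s + t) * r = x) (hr₁ : x * r ≤ 1) (hsx : s ≤ x) :
    1 - r * s * r ≤ 2 • (1 - s) + 4 • t := by
  have key : 2 • (1 - s) + 4 • t - (1 - r * s * r) =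
      (1 - r * (s + t) * r) + 4 • (x - s) + 2 • ((r - 1) * s * (r - 1)) +
        (r - 2) * t * (r - 2) + 2 • (r * (s + t) - x) + 2 • ((s + t) * r - x) := by
    rw [show (2 : R) = 1 + 1 from one_add_one_eq_two.symm]
    noncomm_ring
  rw [← sub_nonneg, key, hrx, hxr, sub_self, smul_zero, add_zero, add_zero]
  have hsr := (hr.sub (.one R)).conjugate_nonneg hs
  have htr := (hr.sub (.ofNat 2)).conjugate_nonneg ht
  exact add_nonneg (add_nonneg (add_nonneg (sub_nonneg.mpr hr₁)
    (nsmul_nonneg (sub_nonneg.mpr hsx) 4)) (nsmul_nonneg hsr 2)) htr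

end StarOrderedRing

theorem le_sqrt_of_le {A : Type*} [CStarAlgebra A] [PartialOrder A] [StarOrderedRing A] {a b : A}
    (ha₀ : 0 ≤ a) (ha₁ : a ≤ 1) (hab : a ≤ b) : a ≤ CFC.sqrt b := by
  have hsq : a ^ 2 ≤ a := by simpa using CStarAlgebra.pow_antitone ha₀ ha₁ one_le_two
  simpa only [CFC.sqrt_sq a ha₀] using CFC.monotone_sqrt (hsq.trans hab)

section Matrix

variable {C : Type*} [Fintype C]

theorem trace_mul_nonneg {M N : Matrix C C ℂ} (hM : 0 ≤ M) (hN : 0 ≤ N) :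
    0 ≤ (M * N).trace := by
  classical
  obtain ⟨X, rfl⟩ := CStarAlgebra.nonneg_iff_eq_star_mul_self.mp hM
  rw [mul_assoc, Matrix.trace_mul_comm]
  exact ((Matrix.nonneg_iff_posSemidef.mp hN).mul_mul_conjTranspose_same X).trace_nonneg

/-- The expectation value `Re Tr (ρ M)` of the observable `M` in the state `ρ`, as a linear
functional of `M`. -/
noncomputable def expectation (ρ : Matrix C C ℂ) : Matrix C C ℂ →ₗ[ℝ] ℝ :=
  Complex.reLm ∘ₗ Matrix.traceLinearMap C ℝ ℂ ∘ₗ LinearMap.mulLeft ℝ ρ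

theorem expectation_apply (ρ M : Matrix C C ℂ) : expectation ρ M = (ρ * M).trace.re := rfl

theorem expectation_nonneg {ρ M : Matrix C C ℂ} (hρ : 0 ≤ ρ) (hM : 0 ≤ M) :
    0 ≤ expectation ρ M :=
  (Complex.le_def.mp (trace_mul_nonneg hρ hM)).1

theorem monotone_expectation {ρ : Matrix C C ℂ} (hρ : 0 ≤ ρ) : Monotone (expectation ρ) :=
  fun M N h => sub_nonneg.mp <| by
    simpa only [map_sub] using expectation_nonneg hρ (sub_nonneg.mpr h)

theorem expectation_sum_smul {ι : Type*} (s : Finset ι) (w : ι → ℝ) (ρ : ι → Matrix C C ℂ)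
    (M : Matrix C C ℂ) :
    expectation (∑ i ∈ s, (w i : ℂ) • ρ i) M = ∑ i ∈ s, w i * expectation (ρ i) M := by
  simp [expectation_apply, Finset.sum_mul, Matrix.trace_sum, Matrix.trace_smul]

variable [DecidableEq C]

theorem expectation_one_right (ρ : Matrix C C ℂ) : expectation ρ 1 = ρ.trace.re := by
  rw [expectation_apply, mul_one]

theorem continuousOn_real_spectrum (f : ℝ → ℝ) (M : Matrix C C ℂ) :
    ContinuousOn f (spectrum ℝ M) :=
  M.finite_real_spectrum.continuousOn f

theorem re_trace_cfc {M : Matrix C C ℂ} (hM : M.IsHermitian) (f : ℝ → ℝ) :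
    (cfc f M).trace.re = ∑ c, f (hM.eigenvalues c) := by
  rw [hM.cfc_eq, Matrix.IsHermitian.cfc, Unitary.conjStarAlgAut_apply, Matrix.trace_mul_comm,
    ← mul_assoc, Unitary.coe_star_mul_self, one_mul, Matrix.trace_diagonal]
  simp

theorem map_eigenvalues_eq_of_charpoly_eq_prod {M : Matrix C C ℂ} (hM : M.IsHermitian) {d : C → ℝ}
    (hd : M.charpoly = ∏ c, (Polynomial.X - Polynomial.C (d c : ℂ))) :
    Finset.univ.val.map hM.eigenvalues = Finset.univ.val.map d := by
  apply Multiset.map_injective Complex.ofReal_injective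
  calc (Finset.univ.val.map hM.eigenvalues).map Complex.ofReal = M.charpoly.roots := by
        rw [hM.roots_charpoly_eq_eigenvalues, Multiset.map_map]; rfl
    _ = (((Finset.univ.val.map d).map Complex.ofReal).map
          fun a => Polynomial.X - Polynomial.C a).prod.roots := by
        rw [hd, Multiset.map_map, Multiset.map_map]; rfl
    _ = _ := Polynomial.roots_multiset_prod_X_sub_C _

theorem re_trace_cfc_of_charpoly_eq_prod {M : Matrix C C ℂ} (hM : M.IsHermitian) {d : C → ℝ}
    (hd : M.charpoly = ∏ c, (Polynomial.X - Polynomial.C (d c : ℂ))) (f : ℝ → ℝ) :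
    (cfc f M).trace.re = ∑ c, f (d c) := by
  have h := congrArg (fun s => (s.map f).sum) (map_eigenvalues_eq_of_charpoly_eq_prod hM hd)
  simp only [Multiset.map_map] at h
  exact (re_trace_cfc hM f).trans h

theorem vonNeumannEntropy_eq {M : Matrix C C ℂ} (hM : M.IsHermitian) :
    vonNeumannEntropy M = -∑ c, hM.eigenvalues c * Real.logb 2 (hM.eigenvalues c) :=
  congrArg Neg.neg (re_trace_cfc hM _)

theorem sum_eigenvalues_eq_one {M : Matrix C C ℂ} (hM : M.IsHermitian) (h : M.trace = 1) :
    ∑ c, hM.eigenvalues c = 1 := by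
  simpa [hM.trace_eq_sum_eigenvalues, ← Complex.ofReal_sum] using h

theorem isSelfAdjoint_invSqrt (M : Matrix C C ℂ) : IsSelfAdjoint (invSqrt M) :=
  cfc_predicate _ M

theorem sqrt_eq_cfc {M : Matrix C C ℂ} (hM : 0 ≤ M) : CFC.sqrt M = cfc Real.sqrt M := by
  rw [CFC.sqrt_eq_real_sqrt M, cfcₙ_eq_cfc]

theorem invSqrt_mul_self {M : Matrix C C ℂ} (hM : 0 ≤ M) : invSqrt M * M = CFC.sqrt M := by
  nth_rw 2 [← cfc_id' ℝ M]
  rw [sqrt_eq_cfc hM, invSqrt,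
    ← cfc_mul _ _ M (continuousOn_real_spectrum _ M) (continuousOn_real_spectrum _ M)]
  simp only [inv_mul_eq_div, Real.div_sqrt]

theorem self_mul_invSqrt {M : Matrix C C ℂ} (hM : 0 ≤ M) : M * invSqrt M = CFC.sqrt M := by
  simpa only [star_mul, (isSelfAdjoint_invSqrt M).star_eq, (IsSelfAdjoint.of_nonneg hM).star_eq,
    (IsSelfAdjoint.of_nonneg (CFC.sqrt_nonneg M)).star_eq] using congrArg star (invSqrt_mul_self hM)

theorem sqrt_mul_invSqrt_le_one {M : Matrix C C ℂ} (hM : 0 ≤ M) : CFC.sqrt M * invSqrt M ≤ 1 := by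
  rw [sqrt_eq_cfc hM, invSqrt,
    ← cfc_mul _ _ M (continuousOn_real_spectrum _ M) (continuousOn_real_spectrum _ M)]
  exact cfc_le_one _ M fun t _ => mul_inv_le_one

open scoped Matrix.Norms.L2Operator in
/-- The **Hayashi–Nagaoka inequality**. -/
theorem one_sub_invSqrt_conj_le {S T : Matrix C C ℂ} (hS₀ : 0 ≤ S) (hS₁ : S ≤ 1) (hT : 0 ≤ T) :
    1 - invSqrt (S + T) * S * invSqrt (S + T) ≤ 2 • (1 - S) + 4 • T := by
  have hST : 0 ≤ S + T := add_nonneg hS₀ hT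
  exact one_sub_conj_le_of_mul_eq (isSelfAdjoint_invSqrt _) hS₀ hT (invSqrt_mul_self hST)
    (self_mul_invSqrt hST) (sqrt_mul_invSqrt_le_one hST)
    (le_sqrt_of_le hS₀ hS₁ (le_add_of_nonneg_right hT))

theorem isStarProjection_spectralProj (M : Matrix C C ℂ) (a b : ℝ) :
    IsStarProjection (spectralProj M a b) := by
  refine ⟨?_, cfc_predicate _ M⟩
  rw [IsIdempotentElem, spectralProj,
    ← cfc_mul _ _ M (continuousOn_real_spectrum _ M) (continuousOn_real_spectrum _ M)]
  refine cfc_congr fun t _ => ?_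
  by_cases ht : t ∈ Set.Icc a b <;> simp [ht]

theorem mul_spectralProj {M : Matrix C C ℂ} (hM : IsSelfAdjoint M) (a b : ℝ) :
    M * spectralProj M a b = cfc ((Set.Icc a b).indicator fun t => t) M := by
  nth_rw 1 [← cfc_id' ℝ M]
  rw [spectralProj,
    ← cfc_mul _ _ M (continuousOn_real_spectrum _ M) (continuousOn_real_spectrum _ M)]
  refine cfc_congr fun t _ => ?_
  by_cases ht : t ∈ Set.Icc a b <;> simp [ht]

theorem spectralProj_conj_le {M : Matrix C C ℂ} (hM : IsSelfAdjoint M) (a : ℝ) {b : ℝ}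
    (hb : 0 ≤ b) :
    spectralProj M a b * M * spectralProj M a b ≤ b • 1 := by
  rw [mul_assoc, mul_spectralProj hM, spectralProj,
    ← cfc_mul _ _ M (continuousOn_real_spectrum _ M) (continuousOn_real_spectrum _ M),
    ← Algebra.algebraMap_eq_smul_one]
  refine cfc_le_algebraMap _ _ M (fun t _ => ?_) (continuousOn_real_spectrum _ M)
  by_cases htab : t ∈ Set.Icc a b
  · simpa [htab] using htab.2
  · simpa [htab] using hb

theorem smul_spectralProj_le {M : Matrix C C ℂ} (hM : 0 ≤ M) (a b : ℝ) :
    a • spectralProj M a b ≤ M := by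
  nth_rw 2 [← cfc_id' ℝ M]
  rw [spectralProj, ← cfc_const_mul _ _ M (continuousOn_real_spectrum _ M)]
  refine cfc_mono (fun t ht => ?_) (continuousOn_real_spectrum _ M)
    (continuousOn_real_spectrum _ M)
  by_cases htab : t ∈ Set.Icc a b
  · simpa [htab] using htab.1
  · simpa [htab] using spectrum_nonneg_of_nonneg hM ht

theorem expectation_self_one_sub_spectralProj {M : Matrix C C ℂ} (hM : IsSelfAdjoint M) (a b : ℝ) :
    expectation M (1 - spectralProj M a b) =
      (cfc ((Set.Icc a b)ᶜ.indicator fun t => t) M).trace.re := by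
  rw [expectation_apply, mul_sub, mul_one, mul_spectralProj hM]
  nth_rw 1 [← cfc_id' ℝ M]
  rw [← cfc_sub _ _ M (continuousOn_real_spectrum _ M) (continuousOn_real_spectrum _ M),
    Set.indicator_compl]
  rfl

theorem expectation_spectralProj_conj_le {R S : Matrix C C ℂ} (hR : IsSelfAdjoint R) (hS : 0 ≤ S)
    (a' : ℝ) {a b' : ℝ} (b : ℝ) (ha : 0 < a) (hb' : 0 ≤ b') :
    expectation R (spectralProj R a' b' * spectralProj S a b * spectralProj R a' b') ≤
      b' * a⁻¹ * S.trace.re := by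
  set P := spectralProj R a' b'
  set Q := spectralProj S a b
  have hQ : 0 ≤ Q := (isStarProjection_spectralProj S a b).nonneg
  have hle : Q.trace.re ≤ a⁻¹ * S.trace.re := by
    have := monotone_expectation (zero_le_one (α := Matrix C C ℂ))
      (smul_spectralProj_le hS a b)
    rw [map_smul, smul_eq_mul, expectation_apply, expectation_apply, one_mul, one_mul] at this
    rwa [inv_mul_eq_div, le_div_iff₀' ha]
  calc expectation R (P * Q * P) = expectation Q (P * R * P) := by
        have h := Matrix.trace_mul_comm (R * P) (Q * P)
        simp only [mul_assoc] at h
        simp only [expectation_apply, mul_assoc, h]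
    _ ≤ expectation Q (b' • 1) := monotone_expectation hQ (spectralProj_conj_le hR a' hb')
    _ = b' * Q.trace.re := by rw [map_smul, expectation_one_right, smul_eq_mul]
    _ ≤ b' * a⁻¹ * S.trace.re := by
        rw [mul_assoc]
        exact mul_le_mul_of_nonneg_left hle hb'

end Matrix

section PrettyGoodMeasurement

variable {X Y C : Type*} [Fintype X] [DecidableEq Y] [Fintype C] [DecidableEq C]

/-- The element at `x` of the pretty good measurement `T^{-1/2} Λ_x T^{-1/2}` formed from the
operators `Λ_y` of those candidates `y` that have the same hash value under `f` as `x`. -/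
noncomputable def prettyGoodMeasurement (Λ : X → Matrix C C ℂ) (f : X → Y) (x : X) : Matrix C C ℂ :=
  invSqrt (∑ y with f y = f x, Λ y) * Λ x * invSqrt (∑ y with f y = f x, Λ y)

variable {Λ : X → Matrix C C ℂ} (hΛ : ∀ x, 0 ≤ Λ x)
include hΛ

theorem prettyGoodMeasurement_nonneg (f : X → Y) (x : X) : 0 ≤ prettyGoodMeasurement Λ f x :=
  (isSelfAdjoint_invSqrt _).conjugate_nonneg (hΛ x)

theorem sum_prettyGoodMeasurement_le_one (f : X → Y) (h : Y) :
    ∑ x with f x = h, prettyGoodMeasurement Λ f x ≤ 1 := by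
  set T := ∑ x with f x = h, Λ x
  have hT₀ : 0 ≤ T := Finset.sum_nonneg fun x _ => hΛ x
  calc ∑ x with f x = h, prettyGoodMeasurement Λ f x
      = ∑ x with f x = h, invSqrt T * Λ x * invSqrt T :=
        Finset.sum_congr rfl fun x hx => by
          rw [prettyGoodMeasurement, (Finset.mem_filter.mp hx).2]
    _ = invSqrt T * T * invSqrt T := by rw [← Finset.sum_mul, ← Finset.mul_sum]
    _ ≤ 1 := by rw [invSqrt_mul_self hT₀]; exact sqrt_mul_invSqrt_le_one hT₀

theorem prettyGoodMeasurement_le_one (f : X → Y) (x : X) : prettyGoodMeasurement Λ f x ≤ 1 :=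
  (Finset.single_le_sum (fun y _ => prettyGoodMeasurement_nonneg hΛ f y) (by simp)).trans
    (sum_prettyGoodMeasurement_le_one hΛ f (f x))

theorem expectation_one_sub_prettyGoodMeasurement_le [DecidableEq X] {ρ : Matrix C C ℂ}
    (hρ : 0 ≤ ρ) (f : X → Y) {x : X} (hx : Λ x ≤ 1) :
    expectation ρ (1 - prettyGoodMeasurement Λ f x) ≤
      2 * expectation ρ (1 - Λ x) + 4 * ∑ y with y ≠ x ∧ f y = f x, expectation ρ (Λ y) := by
  have hsplit : ∑ y with f y = f x, Λ y = Λ x + ∑ y with y ≠ x ∧ f y = f x, Λ y := by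
    rw [← Finset.add_sum_erase _ Λ (by simp : x ∈ ({y | f y = f x} : Finset X))]
    congr 2
    ext y
    simp
  have h := monotone_expectation hρ (one_sub_invSqrt_conj_le (hΛ x) hx
    (Finset.sum_nonneg fun y _ => hΛ y : 0 ≤ ∑ y with y ≠ x ∧ f y = f x, Λ y))
  rw [map_add, map_nsmul, map_nsmul, map_sum] at h
  simpa only [prettyGoodMeasurement, hsplit, nsmul_eq_mul, Nat.cast_ofNat] using h

end PrettyGoodMeasurement

namespace RandomHash

variable {X Y K : Type*} [Fintype Y] [Fintype K]

theorem card_pos [Nonempty X] (F : RandomHash X Y K) : 0 < Fintype.card Y := by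
  obtain ⟨k, -, -⟩ := Finset.exists_ne_zero_of_sum_ne_zero (F.q_sum.trans_ne one_ne_zero)
  exact Fintype.card_pos_iff.mpr ⟨F.f k (Classical.arbitrary X)⟩

variable [Fintype X] [DecidableEq Y] {F : RandomHash X Y K}

theorem IsTwoUniversal.sum_collisions_le [DecidableEq X] (hF : F.IsTwoUniversal)
    (x : X) {t : X → ℝ} (ht : ∀ y, 0 ≤ t y) :
    ∑ k, F.q k * ∑ y with y ≠ x ∧ F.f k y = F.f k x, t y ≤ 1 / Fintype.card Y * ∑ y, t y := by
  calc ∑ k, F.q k * ∑ y with y ≠ x ∧ F.f k y = F.f k x, t y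
      = ∑ y with y ≠ x, (∑ k with F.f k y = F.f k x, F.q k) * t y := by
        simp only [← Finset.filter_filter, Finset.sum_filter (fun y => F.f _ y = F.f _ x),
          Finset.sum_filter (fun k => F.f k _ = F.f k x), Finset.mul_sum, Finset.sum_mul,
          mul_ite, ite_mul, mul_zero, zero_mul]
        exact Finset.sum_comm
    _ ≤ ∑ y with y ≠ x, 1 / Fintype.card Y * t y :=
        Finset.sum_le_sum fun y hy =>
          mul_le_mul_of_nonneg_right (hF y x (Finset.mem_filter.mp hy).2) (ht y)
    _ ≤ ∑ y, 1 / Fintype.card Y * t y :=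
        Finset.sum_le_sum_of_subset_of_nonneg (Finset.filter_subset _ _)
          fun y _ _ => mul_nonneg (by positivity) (ht y)
    _ = 1 / Fintype.card Y * ∑ y, t y := (Finset.mul_sum ..).symm

variable {C : Type*} [Fintype C] [DecidableEq C] {Λ : X → Matrix C C ℂ}

theorem IsTwoUniversal.sum_expectation_one_sub_prettyGoodMeasurement_le (hF : F.IsTwoUniversal)
    (hΛ₀ : ∀ x, 0 ≤ Λ x) {ρ : Matrix C C ℂ} (hρ : 0 ≤ ρ) {x : X} (hx : Λ x ≤ 1) :
    ∑ k, F.q k * expectation ρ (1 - prettyGoodMeasurement Λ (F.f k) x) ≤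
      2 * expectation ρ (1 - Λ x) + 4 / Fintype.card Y * ∑ y, expectation ρ (Λ y) := by
  classical
  set t : X → ℝ := fun y => expectation ρ (Λ y)
  calc ∑ k, F.q k * expectation ρ (1 - prettyGoodMeasurement Λ (F.f k) x)
      ≤ ∑ k, F.q k * (2 * expectation ρ (1 - Λ x) +
          4 * ∑ y with y ≠ x ∧ F.f k y = F.f k x, t y) :=
        Finset.sum_le_sum fun k _ => mul_le_mul_of_nonneg_left
          (expectation_one_sub_prettyGoodMeasurement_le hΛ₀ hρ (F.f k) hx) (F.q_nonneg k)
    _ = 2 * expectation ρ (1 - Λ x) +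
          4 * ∑ k, F.q k * ∑ y with y ≠ x ∧ F.f k y = F.f k x, t y := by
        simp only [mul_add, Finset.sum_add_distrib, ← Finset.sum_mul, F.q_sum, one_mul,
          mul_left_comm (F.q _) 4, ← Finset.mul_sum]
    _ ≤ 2 * expectation ρ (1 - Λ x) + 4 * (1 / Fintype.card Y * ∑ y, t y) := by
        gcongr
        exact hF.sum_collisions_le x fun y => expectation_nonneg hρ (hΛ₀ y)
    _ = 2 * expectation ρ (1 - Λ x) + 4 / Fintype.card Y * ∑ y, t y := by ring

theorem IsTwoUniversal.sum_error_prettyGoodMeasurement_le (hF : F.IsTwoUniversal)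
    (hΛ₀ : ∀ x, 0 ≤ Λ x) (hΛ₁ : ∀ x, Λ x ≤ 1) {p : X → ℝ} (hp : ∀ x, 0 ≤ p x)
    {ρ : X → Matrix C C ℂ} (hρ : ∀ x, 0 ≤ ρ x) :
    ∑ k, F.q k * ∑ x, p x * expectation (ρ x) (1 - prettyGoodMeasurement Λ (F.f k) x) ≤
      2 * ∑ x, p x * expectation (ρ x) (1 - Λ x) +
        4 / Fintype.card Y * ∑ y, expectation (∑ x, (p x : ℂ) • ρ x) (Λ y) := by
  calc ∑ k, F.q k * ∑ x, p x * expectation (ρ x) (1 - prettyGoodMeasurement Λ (F.f k) x)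
      = ∑ x, p x * ∑ k, F.q k * expectation (ρ x) (1 - prettyGoodMeasurement Λ (F.f k) x) := by
        simp only [Finset.mul_sum, mul_left_comm (F.q _)]
        exact Finset.sum_comm
    _ ≤ ∑ x, p x * (2 * expectation (ρ x) (1 - Λ x) +
          4 / Fintype.card Y * ∑ y, expectation (ρ x) (Λ y)) :=
        Finset.sum_le_sum fun x _ => mul_le_mul_of_nonneg_left
          (hF.sum_expectation_one_sub_prettyGoodMeasurement_le hΛ₀ (hρ x) (hΛ₁ x)) (hp x)
    _ = _ := by
        simp only [expectation_sum_smul, mul_add, Finset.sum_add_distrib, Finset.mul_sum,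
          mul_left_comm (p _)]
        rw [Finset.sum_comm (f := fun x y => 4 / (Fintype.card Y : ℝ) * (p x * _))]

end RandomHash

section LawOfLargeNumbers

open MeasureTheory ProbabilityTheory Filter Topology

theorem tendsto_measureReal_pi_abs_sum_sub_ge {Ω : Type*} [MeasurableSpace Ω] {μ : Measure Ω}
    [IsProbabilityMeasure μ] {X : Ω → ℝ} (hX : MemLp X 2 μ) {δ : ℝ} (hδ : 0 < δ) :
    Tendsto (fun n : ℕ => (Measure.pi fun _ : Fin n => μ).real
      {ω | n * δ ≤ |∑ i, X (ω i) - n * μ[X]|}) atTop (𝓝 0) := by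
  have hlim : Tendsto (fun n : ℕ => Var[X; μ] / δ ^ 2 / n) atTop (𝓝 0) :=
    tendsto_const_div_atTop_nhds_zero_nat _
  refine squeeze_zero' (.of_forall fun n => measureReal_nonneg) ?_ hlim
  filter_upwards [eventually_gt_atTop 0] with n hn
  have hXi (i : Fin n) : MemLp (fun ω : Fin n → Ω => X (ω i)) 2 (Measure.pi fun _ => μ) :=
    hX.comp_measurePreserving (measurePreserving_eval _ i)
  have hmean : ∫ ω, ∑ i, X (ω i) ∂(Measure.pi fun _ : Fin n => μ) = n * μ[X] := by
    rw [integral_finsetSum _ fun i _ => (hXi i).integrable one_le_two]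
    simp [integral_comp_eval (μ := fun _ : Fin n => μ) hX.aestronglyMeasurable]
  have hvar : Var[fun ω => ∑ i, X (ω i); Measure.pi fun _ : Fin n => μ] = n * Var[X; μ] := by
    simpa [Finset.sum_fn] using variance_sum_pi (ι := Fin n) fun _ => hX
  have h := meas_ge_le_variance_div_sq (memLp_finsetSum Finset.univ fun i _ => hXi i)
    (by positivity : 0 < n * δ)
  rw [hmean, hvar] at h
  calc _ ≤ n * Var[X; μ] / (n * δ) ^ 2 :=
        ENNReal.toReal_le_of_le_ofReal
          (div_nonneg (mul_nonneg n.cast_nonneg (variance_nonneg X μ)) (sq_nonneg _)) h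
    _ = Var[X; μ] / δ ^ 2 / n := by field_simp

theorem tendsto_sum_prod_abs_sum_sub_ge {Ω : Type*} [Fintype Ω] {w : Ω → ℝ} (hw : ∀ o, 0 ≤ w o)
    (hw₁ : ∑ o, w o = 1) (X : Ω → ℝ) {δ : ℝ} (hδ : 0 < δ) :
    Tendsto (fun n : ℕ => ∑ ω : Fin n → Ω with n * δ ≤ |∑ i, X (ω i) - n * ∑ o, w o * X o|,
      ∏ i, w (ω i)) atTop (𝓝 0) := by
  let _ : MeasurableSpace Ω := ⊤
  let P : PMF Ω := PMF.ofFintype (fun o => ENNReal.ofReal (w o)) <| by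
    rw [← ENNReal.ofReal_sum_of_nonneg fun o _ => hw o, hw₁, ENNReal.ofReal_one]
  have hP (o : Ω) : P.toMeasure.real {o} = w o := by
    rw [Measure.real, P.toMeasure_apply_singleton o (measurableSet_singleton o)]
    exact ENNReal.toReal_ofReal (hw o)
  have hmean : P.toMeasure[X] = ∑ o, w o * X o := by
    simp [integral_fintype (MemLp.of_discrete.integrable (q := 1) le_rfl), hP]
  refine (tendsto_measureReal_pi_abs_sum_sub_ge (μ := P.toMeasure) (X := X) .of_discrete hδ).congr
    fun n => ?_
  rw [hmean, ← Finset.coe_filter_univ, ← sum_measureReal_singleton]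
  refine Finset.sum_congr rfl fun ω _ => ?_
  rw [Measure.real, Measure.pi_singleton, ENNReal.toReal_prod]
  exact Finset.prod_congr rfl fun i _ => hP (ω i)

end LawOfLargeNumbers

section Typicality

variable {Ω : Type*} [Fintype Ω]

/-- The probabilities regarded as typical for blocks of length `n` from a source of entropy `h`:
those within a factor `2^{± n δ}` of `2^{-n h}`. -/
def typicalInterval (h δ : ℝ) (n : ℕ) : Set ℝ :=
  Set.Icc ((2 : ℝ) ^ (-(n : ℝ) * (h + δ))) ((2 : ℝ) ^ (-(n : ℝ) * (h - δ)))

theorem mem_typicalInterval_iff {h δ t : ℝ} {n : ℕ} (ht : 0 < t) :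
    t ∈ typicalInterval h δ n ↔ |-Real.logb 2 t - n * h| ≤ n * δ := by
  rw [typicalInterval, Set.mem_Icc, ← Real.le_logb_iff_rpow_le one_lt_two ht,
    ← Real.logb_le_iff_le_rpow one_lt_two ht, abs_le]
  constructor <;> rintro ⟨h₁, h₂⟩ <;> constructor <;> linarith

/-- The probability that the product of `g` along a block of `n` independent letters drawn from
the distribution `w` falls outside `typicalInterval h δ n`. -/
noncomputable def atypicalMass (w g : Ω → ℝ) (h δ : ℝ) (n : ℕ) : ℝ :=
  ∑ ω : Fin n → Ω, (typicalInterval h δ n)ᶜ.indicator (fun _ => ∏ i, w (ω i)) (∏ i, g (ω i))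

variable {w : Ω → ℝ} (hw : ∀ o, 0 ≤ w o)
include hw

theorem atypicalMass_nonneg (g : Ω → ℝ) (h δ : ℝ) (n : ℕ) : 0 ≤ atypicalMass w g h δ n :=
  Finset.sum_nonneg fun _ _ =>
    Set.indicator_apply_nonneg fun _ => Finset.prod_nonneg fun _ _ => hw _

theorem atypicalMass_le_sum_prod {g : Ω → ℝ} (hg : ∀ o, w o ≠ 0 → 0 < g o) (h δ : ℝ) (n : ℕ) :
    atypicalMass w g h δ n ≤
      ∑ ω : Fin n → Ω with n * δ ≤ |∑ i, -Real.logb 2 (g (ω i)) - n * h|, ∏ i, w (ω i) := by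
  rw [atypicalMass, Finset.sum_filter]
  refine Finset.sum_le_sum fun ω _ => ?_
  have hprod : 0 ≤ ∏ i, w (ω i) := Finset.prod_nonneg fun i _ => hw (ω i)
  split_ifs with hdev
  · exact Set.indicator_apply_le' (fun _ => le_rfl) fun _ => hprod
  · refine Set.indicator_apply_le' (fun hω => ?_) fun _ => le_rfl
    by_contra! hpos
    have hgω (i : Fin n) : 0 < g (ω i) :=
      hg _ (Finset.prod_ne_zero_iff.mp hpos.ne' i (Finset.mem_univ i))
    refine hω ((mem_typicalInterval_iff (Finset.prod_pos fun i _ => hgω i)).mpr ?_)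
    rw [Real.logb_prod _ _ fun i _ => (hgω i).ne', ← Finset.sum_neg_distrib]
    exact (not_le.mp hdev).le

theorem tendsto_atypicalMass (hw₁ : ∑ o, w o = 1) {g : Ω → ℝ} (hg : ∀ o, w o ≠ 0 → 0 < g o)
    {δ : ℝ} (hδ : 0 < δ) :
    Filter.Tendsto (atypicalMass w g (-∑ o, w o * Real.logb 2 (g o)) δ) Filter.atTop (nhds 0) := by
  refine squeeze_zero (atypicalMass_nonneg hw g _ δ) (atypicalMass_le_sum_prod hw hg _ δ) ?_
  simpa only [mul_neg, Finset.sum_neg_distrib] using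
    tendsto_sum_prod_abs_sum_sub_ge hw hw₁ (fun o => -Real.logb 2 (g o)) hδ

end Typicality

section Tensor

variable {B : Type*} {n : ℕ}

theorem star_tensor (M : Fin n → Matrix B B ℂ) : star (tensor M) = tensor fun i => star (M i) := by
  ext b b'
  simp [tensor, Matrix.star_apply]

theorem isHermitian_tensor {M : Fin n → Matrix B B ℂ} (hM : ∀ i, (M i).IsHermitian) :
    (tensor M).IsHermitian :=
  (star_tensor M).trans (congrArg tensor (funext hM))

theorem tensor_diagonal [DecidableEq B] (d : Fin n → B → ℂ) :
    tensor (fun i => Matrix.diagonal (d i)) = Matrix.diagonal fun b => ∏ i, d i (b i) := by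
  ext b b'
  by_cases h : b = b'
  · simp [h, tensor]
  · obtain ⟨i, hi⟩ := Function.ne_iff.mp h
    rw [Matrix.diagonal_apply_ne _ h]
    exact Finset.prod_eq_zero (Finset.mem_univ i) (Matrix.diagonal_apply_ne _ hi)

theorem tensor_one [DecidableEq B] : tensor (fun _ : Fin n => (1 : Matrix B B ℂ)) = 1 := by
  simpa using tensor_diagonal (n := n) fun _ (_ : B) => 1

theorem tensor_mul [Fintype B] (M N : Fin n → Matrix B B ℂ) :
    tensor M * tensor N = tensor fun i => M i * N i := by
  ext b b'
  simp only [tensor, Matrix.mul_apply, Matrix.of_apply, ← Finset.prod_mul_distrib]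
  exact (Fintype.prod_sum fun i c => M i (b i) c * N i c (b' i)).symm

theorem trace_tensor [Fintype B] (M : Fin n → Matrix B B ℂ) : (tensor M).trace = ∏ i, (M i).trace :=
  (Fintype.prod_sum fun i c => M i c c).symm

theorem tensor_nonneg [Finite B] {M : Fin n → Matrix B B ℂ} (hM : ∀ i, 0 ≤ M i) : 0 ≤ tensor M := by
  classical
  have := Fintype.ofFinite B
  choose X hX using fun i => CStarAlgebra.nonneg_iff_eq_star_mul_self.mp (hM i)
  have hfactor : tensor M = star (tensor X) * tensor X := by
    rw [star_tensor, tensor_mul]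
    exact congrArg tensor (funext hX)
  exact hfactor ▸ star_mul_self_nonneg _

variable [Fintype B] [DecidableEq B]

theorem charpoly_tensor {M : Fin n → Matrix B B ℂ} (hM : ∀ i, (M i).IsHermitian) :
    (tensor M).charpoly = ∏ b : Fin n → B,
      (Polynomial.X - Polynomial.C ((∏ i, (hM i).eigenvalues (b i) : ℝ) : ℂ)) := by
  let U : Fin n → Matrix B B ℂ := fun i => (hM i).eigenvectorUnitary
  let D : Fin n → Matrix B B ℂ := fun i => Matrix.diagonal fun b => ((hM i).eigenvalues b : ℂ)
  have hU : star (tensor U) * tensor U = 1 := by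
    rw [star_tensor, tensor_mul, ← tensor_one]
    exact congrArg tensor (funext fun i => Unitary.coe_star_mul_self (hM i).eigenvectorUnitary)
  have hspectral : tensor M = tensor U * tensor D * star (tensor U) := by
    rw [star_tensor, tensor_mul, tensor_mul]
    exact congrArg tensor (funext fun i => (hM i).spectral_theorem)
  rw [hspectral, Matrix.charpoly_mul_comm, ← mul_assoc, hU, one_mul, tensor_diagonal,
    Matrix.charpoly_diagonal]
  simp only [Complex.ofReal_prod]

theorem expectation_tensor_one_sub_spectralProj {M : Fin n → Matrix B B ℂ}
    (hM : ∀ i, (M i).IsHermitian) (a b : ℝ) :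
    expectation (tensor M) (1 - spectralProj (tensor M) a b) =
      ∑ c : Fin n → B, (Set.Icc a b)ᶜ.indicator (fun t => t) (∏ i, (hM i).eigenvalues (c i)) := by
  have hT := isHermitian_tensor hM
  rw [expectation_self_one_sub_spectralProj hT,
    re_trace_cfc_of_charpoly_eq_prod hT (charpoly_tensor hM)]

end Tensor

namespace Ensemble

variable {A B : Type*} [Fintype A] [Fintype B] (E : Ensemble A B) {n : ℕ}

include E in
theorem nonempty_alphabet : Nonempty A := by
  obtain ⟨a, -, -⟩ := Finset.exists_ne_zero_of_sum_ne_zero (E.p_sum.trans_ne one_ne_zero)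
  exact ⟨a⟩

theorem ρ_nonneg (a : A) : 0 ≤ E.ρ a :=
  Matrix.nonneg_iff_posSemidef.mpr (E.ρ_posSemidef a)

theorem avg_nonneg : 0 ≤ E.avg :=
  Finset.sum_nonneg fun a _ => Matrix.nonneg_iff_posSemidef.mpr
    ((E.ρ_posSemidef a).smul (Complex.zero_le_real.mpr (E.p_nonneg a)))

theorem trace_avg : E.avg.trace = 1 := by
  simp only [avg, Matrix.trace_sum, Matrix.trace_smul, E.ρ_trace, smul_eq_mul, mul_one]
  exact_mod_cast E.p_sum

theorem blockProb_nonneg (x : Fin n → A) : 0 ≤ E.blockProb x :=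
  Finset.prod_nonneg fun i _ => E.p_nonneg (x i)

theorem sum_blockProb : ∑ x : Fin n → A, E.blockProb x = 1 := by
  simp only [blockProb, ← Fintype.prod_sum fun (_ : Fin n) a => E.p a, E.p_sum,
    Finset.prod_const_one]

theorem blockState_nonneg (x : Fin n → A) : 0 ≤ E.blockState x :=
  tensor_nonneg fun i => E.ρ_nonneg (x i)

theorem trace_blockState (x : Fin n → A) : (E.blockState x).trace = 1 := by
  simp only [blockState, trace_tensor, E.ρ_trace, Finset.prod_const_one]

theorem sum_blockProb_smul_blockState :
    ∑ x : Fin n → A, (E.blockProb x : ℂ) • E.blockState x = tensor fun _ => E.avg := by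
  ext b b'
  simp only [Matrix.sum_apply, Matrix.smul_apply, blockProb, blockState, tensor, Matrix.of_apply,
    avg, smul_eq_mul, Complex.ofReal_prod, ← Finset.prod_mul_distrib]
  exact (Fintype.prod_sum fun i a => (E.p a : ℂ) * E.ρ a (b i) (b' i)).symm

variable [DecidableEq B] (δ : ℝ)

theorem isStarProjection_typProj : IsStarProjection (E.typProj δ n) :=
  isStarProjection_spectralProj _ _ _

theorem isStarProjection_condTypProj (x : Fin n → A) : IsStarProjection (E.condTypProj δ x) :=
  isStarProjection_spectralProj _ _ _

theorem Λ_nonneg (x : Fin n → A) : 0 ≤ E.Λ δ x := by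
  unfold Λ
  split_ifs
  · exact (E.isStarProjection_typProj δ).isSelfAdjoint.conjugate_nonneg
      (E.isStarProjection_condTypProj δ x).nonneg
  · exact le_rfl

theorem Λ_le_one (x : Fin n → A) : E.Λ δ x ≤ 1 := by
  unfold Λ
  split_ifs
  · have hP := E.isStarProjection_typProj (n := n) δ
    calc E.typProj δ n * E.condTypProj δ x * E.typProj δ n
        ≤ E.typProj δ n * 1 * E.typProj δ n :=
          IsSelfAdjoint.conjugate_le_conjugate (E.isStarProjection_condTypProj δ x).le_one
            hP.isSelfAdjoint
      _ = E.typProj δ n := by rw [mul_one, hP.isIdempotentElem]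
      _ ≤ 1 := hP.le_one
  · exact zero_le_one

theorem one_sub_Λ_le (x : Fin n → A) :
    1 - E.Λ δ x ≤ (typicalInterval E.H δ n)ᶜ.indicator (1 : ℝ → ℝ) (E.blockProb x) • 1 +
      (3 • (1 - E.typProj δ n) + 2 • (1 - E.condTypProj δ x)) := by
  have hP := E.isStarProjection_typProj (n := n) δ
  have hQ := E.isStarProjection_condTypProj δ x
  unfold Λ
  split_ifs with hx
  · rw [Set.indicator_of_notMem (not_not.mpr hx), zero_smul, zero_add]
    exact one_sub_conj_le hP hQ.nonneg hQ.le_one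
  · rw [Set.indicator_of_mem hx, Pi.one_apply, one_smul, sub_zero]
    exact le_add_of_nonneg_right (add_nonneg (nsmul_nonneg (sub_nonneg.mpr hP.le_one) 3)
      (nsmul_nonneg (sub_nonneg.mpr hQ.le_one) 2))

theorem expectation_tensor_avg_Λ_le (x : Fin n → A) :
    expectation (tensor fun _ => E.avg) (E.Λ δ x) ≤
      E.blockProb x * (2 : ℝ) ^ ((n : ℝ) * (E.H - E.χ + 3 * δ)) := by
  unfold Λ
  split_ifs with hx
  · calc _ ≤ (2 : ℝ) ^ (-(n : ℝ) * (vonNeumannEntropy E.avg - δ)) *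
            ((2 : ℝ) ^ (-(n : ℝ) * (E.condEntropy + δ)))⁻¹ * (E.blockState x).trace.re :=
          expectation_spectralProj_conj_le (.of_nonneg (tensor_nonneg fun _ => E.avg_nonneg))
            (E.blockState_nonneg x) _ _ (by positivity) (by positivity)
      _ = (2 : ℝ) ^ (-(n : ℝ) * (E.H + δ)) * (2 : ℝ) ^ ((n : ℝ) * (E.H - E.χ + 3 * δ)) := by
          rw [E.trace_blockState, Complex.one_re, mul_one, ← Real.rpow_neg zero_le_two,
            ← Real.rpow_add two_pos, ← Real.rpow_add two_pos, χ]
          ring_nf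
      _ ≤ _ := mul_le_mul_of_nonneg_right hx.1 (by positivity)
  · rw [map_zero]
    exact mul_nonneg (E.blockProb_nonneg x) (by positivity)

theorem sum_expectation_tensor_avg_Λ_le :
    ∑ x : Fin n → A, expectation (tensor fun _ => E.avg) (E.Λ δ x) ≤
      (2 : ℝ) ^ ((n : ℝ) * (E.H - E.χ + 3 * δ)) := by
  refine (Finset.sum_le_sum fun x _ => E.expectation_tensor_avg_Λ_le δ x).trans_eq ?_
  rw [← Finset.sum_mul, E.sum_blockProb, one_mul]

/-- The average probability that the operator `Λ_x` fails to detect the state `ρ_x` it is meant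
for: the part of the decoding error that does not come from hash collisions. -/
noncomputable def missError (n : ℕ) : ℝ :=
  ∑ x : Fin n → A, E.blockProb x * expectation (E.blockState x) (1 - E.Λ δ x)

theorem missError_nonneg (n : ℕ) : 0 ≤ E.missError δ n :=
  Finset.sum_nonneg fun x _ => mul_nonneg (E.blockProb_nonneg x)
    (expectation_nonneg (E.blockState_nonneg x) (sub_nonneg.mpr (E.Λ_le_one δ x)))

theorem missError_le (n : ℕ) :
    E.missError δ n ≤ atypicalMass E.p E.p E.H δ n +
      (3 * expectation (tensor fun _ : Fin n => E.avg) (1 - E.typProj δ n) +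
        2 * ∑ x : Fin n → A,
          E.blockProb x * expectation (E.blockState x) (1 - E.condTypProj δ x)) := by
  rw [← E.sum_blockProb_smul_blockState, expectation_sum_smul, atypicalMass, Finset.mul_sum,
    Finset.mul_sum, ← Finset.sum_add_distrib, ← Finset.sum_add_distrib, missError]
  refine Finset.sum_le_sum fun x _ => ?_
  have h := monotone_expectation (E.blockState_nonneg x) (E.one_sub_Λ_le δ x)
  rw [map_add, map_add, map_smul, map_nsmul, map_nsmul, expectation_one_right,
    E.trace_blockState, Complex.one_re, smul_eq_mul, mul_one] at h
  refine (mul_le_mul_of_nonneg_left h (E.blockProb_nonneg x)).trans_eq ?_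
  have hind : E.blockProb x * (typicalInterval E.H δ n)ᶜ.indicator 1 (E.blockProb x) =
      (typicalInterval E.H δ n)ᶜ.indicator (fun _ => ∏ i, E.p (x i)) (∏ i, E.p (x i)) := by
    classical
    simp only [Set.indicator_apply, Pi.one_apply, mul_ite, mul_one, mul_zero, blockProb]
  rw [mul_add, hind, mul_add, nsmul_eq_mul, nsmul_eq_mul, mul_left_comm _ (_ : ℝ),
    mul_left_comm _ ((2 : ℕ) : ℝ)]
  rfl

variable {δ}

theorem tendsto_expectation_one_sub_typProj (hδ : 0 < δ) :
    Filter.Tendsto (fun n : ℕ => expectation (tensor fun _ : Fin n => E.avg) (1 - E.typProj δ n))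
      Filter.atTop (nhds 0) := by
  have hps : E.avg.PosSemidef := Matrix.nonneg_iff_posSemidef.mp E.avg_nonneg
  have h := tendsto_atypicalMass hps.eigenvalues_nonneg
    (sum_eigenvalues_eq_one hps.isHermitian E.trace_avg)
    (fun b hb => (hps.eigenvalues_nonneg b).lt_of_ne' hb) hδ
  rw [← vonNeumannEntropy_eq] at h
  exact h.congr fun n =>
    (expectation_tensor_one_sub_spectralProj (fun _ => hps.isHermitian) _ _).symm

theorem sum_expectation_one_sub_condTypProj (δ : ℝ) (n : ℕ) :
    ∑ x : Fin n → A, E.blockProb x * expectation (E.blockState x) (1 - E.condTypProj δ x) =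
      atypicalMass
        (fun o : A × B => E.p o.1 * (E.ρ_posSemidef o.1).isHermitian.eigenvalues o.2)
        (fun o => (E.ρ_posSemidef o.1).isHermitian.eigenvalues o.2) E.condEntropy δ n := by
  rw [atypicalMass,
    ← (Equiv.arrowProdEquivProdArrow (Fin n) (fun _ => A) (fun _ => B)).symm.sum_comp,
    Fintype.sum_prod_type]
  refine Finset.sum_congr rfl fun x _ => ?_
  rw [blockState, condTypProj, blockState, expectation_tensor_one_sub_spectralProj
    (fun i => (E.ρ_posSemidef (x i)).isHermitian), Finset.mul_sum]
  refine Finset.sum_congr rfl fun b _ => ?_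
  simp only [Equiv.arrowProdEquivProdArrow, Equiv.coe_fn_symm_mk, Finset.prod_mul_distrib,
    blockProb, typicalInterval, Set.indicator_apply, mul_ite, mul_zero]

theorem tendsto_sum_expectation_one_sub_condTypProj (hδ : 0 < δ) :
    Filter.Tendsto (fun n : ℕ => ∑ x : Fin n → A,
      E.blockProb x * expectation (E.blockState x) (1 - E.condTypProj δ x))
      Filter.atTop (nhds 0) := by
  set e : A → B → ℝ := fun a => (E.ρ_posSemidef a).isHermitian.eigenvalues
  have he (a : A) (b : B) : 0 ≤ e a b := (E.ρ_posSemidef a).eigenvalues_nonneg b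
  have he₁ (a : A) : ∑ b, e a b = 1 := sum_eigenvalues_eq_one _ (E.ρ_trace a)
  have hsum : ∑ o : A × B, E.p o.1 * e o.1 o.2 = 1 := by
    simp only [Fintype.sum_prod_type, ← Finset.mul_sum, he₁, mul_one, E.p_sum]
  have hentropy : -∑ o : A × B, E.p o.1 * e o.1 o.2 * Real.logb 2 (e o.1 o.2) =
      E.condEntropy := by
    simp only [condEntropy, vonNeumannEntropy_eq (E.ρ_posSemidef _).isHermitian,
      Fintype.sum_prod_type, mul_assoc, ← Finset.mul_sum, ← Finset.sum_neg_distrib, ← mul_neg, e]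
  have h := tendsto_atypicalMass (fun o : A × B => mul_nonneg (E.p_nonneg o.1) (he o.1 o.2)) hsum
    (g := fun o => e o.1 o.2) (fun o ho => (he _ _).lt_of_ne' (right_ne_zero_of_mul ho)) hδ
  rw [hentropy] at h
  exact h.congr fun n => (E.sum_expectation_one_sub_condTypProj δ n).symm

theorem tendsto_missError (hδ : 0 < δ) :
    Filter.Tendsto (E.missError δ) Filter.atTop (nhds 0) := by
  have hsource : Filter.Tendsto (atypicalMass E.p E.p E.H δ) Filter.atTop (nhds 0) :=
    tendsto_atypicalMass E.p_nonneg E.p_sum (fun a ha => (E.p_nonneg a).lt_of_ne' ha) hδ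
  have h := hsource.add (((E.tendsto_expectation_one_sub_typProj hδ).const_mul 3).add
    ((E.tendsto_sum_expectation_one_sub_condTypProj hδ).const_mul 2))
  simp only [mul_zero, add_zero] at h
  exact squeeze_zero (E.missError_nonneg δ) (E.missError_le δ) h

end Ensemble

section AverageError

variable {A B : Type*} [Fintype A] [Fintype B] [DecidableEq B] (E : Ensemble A B) (δ : ℝ)

theorem avgError_nonneg {n : ℕ} {Y K : Type*} [Fintype K] [DecidableEq Y]
    (F : RandomHash (Fin n → A) Y K) : 0 ≤ avgError E δ F :=
  Finset.sum_nonneg fun k _ => mul_nonneg (F.q_nonneg k) <|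
    Finset.sum_nonneg fun x _ => mul_nonneg (E.blockProb_nonneg x) <|
      expectation_nonneg (E.blockState_nonneg x) <|
        sub_nonneg.mpr (prettyGoodMeasurement_le_one (E.Λ_nonneg δ) (F.f k) x)

theorem avgError_le {n : ℕ} {Y K : Type*} [Fintype Y] [Fintype K] [DecidableEq Y]
    {F : RandomHash (Fin n → A) Y K} (hF : F.IsTwoUniversal) :
    avgError E δ F ≤ 2 * E.missError δ n +
      4 * (2 : ℝ) ^ ((n : ℝ) * (E.H - E.χ + 3 * δ)) / Fintype.card Y := by
  calc avgError E δ F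
      ≤ 2 * E.missError δ n + 4 / Fintype.card Y *
          ∑ x, expectation (∑ x, (E.blockProb x : ℂ) • E.blockState x) (E.Λ δ x) :=
        hF.sum_error_prettyGoodMeasurement_le (E.Λ_nonneg δ) (E.Λ_le_one δ) E.blockProb_nonneg
          E.blockState_nonneg
    _ ≤ 2 * E.missError δ n +
          4 / Fintype.card Y * (2 : ℝ) ^ ((n : ℝ) * (E.H - E.χ + 3 * δ)) := by
        rw [E.sum_blockProb_smul_blockState]
        gcongr
        exact E.sum_expectation_tensor_avg_Λ_le δ
    _ = _ := by rw [div_mul_eq_mul_div]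

theorem rpow_div_le_rpow_neg_pow {r δ c : ℝ} (hc : 0 < c) {n : ℕ}
    (h : n * (r + δ) ≤ Real.logb 2 c) : (2 : ℝ) ^ (n * r) / c ≤ ((2 : ℝ) ^ (-δ)) ^ n := by
  rw [div_le_iff₀ hc]
  calc (2 : ℝ) ^ (n * r) = ((2 : ℝ) ^ (-δ)) ^ n * (2 : ℝ) ^ (n * (r + δ)) := by
        rw [← Real.rpow_mul_natCast zero_le_two, ← Real.rpow_add two_pos]
        ring_nf
    _ ≤ ((2 : ℝ) ^ (-δ)) ^ n * c := by
        gcongr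
        exact (Real.le_logb_iff_rpow_le one_lt_two hc).mp h

variable {δ}

theorem tendsto_avgError (hδ : 0 < δ) {Y K : ℕ → Type*} [∀ n, Fintype (Y n)]
    [∀ n, DecidableEq (Y n)] [∀ n, Fintype (K n)]
    {F : ∀ n, RandomHash (Fin n → A) (Y n) (K n)} (hF : ∀ n, (F n).IsTwoUniversal)
    (hY : ∀ n : ℕ, (n : ℝ) * (E.H - E.χ + 4 * δ) ≤ Real.logb 2 (Fintype.card (Y n) : ℝ)) :
    Filter.Tendsto (fun n => avgError E δ (F n)) Filter.atTop (nhds 0) := by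
  have hA : Nonempty A := E.nonempty_alphabet
  have hgeom : Filter.Tendsto (fun n : ℕ => ((2 : ℝ) ^ (-δ)) ^ n) Filter.atTop (nhds 0) :=
    tendsto_pow_atTop_nhds_zero_of_lt_one (by positivity)
      (Real.rpow_lt_one_of_one_lt_of_neg one_lt_two (neg_lt_zero.mpr hδ))
  have hlim := ((E.tendsto_missError hδ).const_mul 2).add (hgeom.const_mul 4)
  simp only [mul_zero, add_zero] at hlim
  refine squeeze_zero (fun n => avgError_nonneg E δ (F n)) (fun n => ?_) hlim
  refine (avgError_le E δ (hF n)).trans ?_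
  rw [mul_div_assoc]
  gcongr
  refine rpow_div_le_rpow_neg_pow (Nat.cast_pos.mpr (F n).card_pos) ((hY n).trans_eq' ?_)
  ring

end AverageError

end HolevoHash

theorem mainTheorem4 {A B : Type*} [Fintype A] [Fintype B] [DecidableEq B]
    (E : HolevoHash.Ensemble A B) (δ : ℝ) (hδ : 0 < δ) :
    -- for every hash function and every announced value, Bob's operators form a (sub-)POVM
    (∀ (n : ℕ) (Y : Type*) [DecidableEq Y] (f : (Fin n → A) → Y),
      (∀ y, (E.povm δ f y).PosSemidef) ∧
        ∀ h : Y, (1 - ∑ y with f y = h, E.povm δ f y).PosSemidef) ∧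
    -- the bound on the average error probability
    (∀ ε : ℝ, 0 < ε → ∃ N : ℕ, ∀ n : ℕ, N ≤ n →
      ∀ (Y K : Type*) [Fintype Y] [DecidableEq Y] [Fintype K]
        (F : HolevoHash.RandomHash (Fin n → A) Y K), F.IsTwoUniversal →
        HolevoHash.avgError E δ F ≤
          8 * ε + 4 * (2 : ℝ) ^ ((n : ℝ) * (E.H - E.χ + 3 * δ)) / (Fintype.card Y : ℝ)) ∧
    -- vanishing error when the hash has `n [H(p) - χ + 4 δ]` bits
    (∀ (Y K : ℕ → Type*) [∀ n, Fintype (Y n)] [∀ n, DecidableEq (Y n)] [∀ n, Fintype (K n)]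
      (F : ∀ n, HolevoHash.RandomHash (Fin n → A) (Y n) (K n)),
      (∀ n, (F n).IsTwoUniversal) →
      (∀ n : ℕ, (n : ℝ) * (E.H - E.χ + 4 * δ) ≤ Real.logb 2 (Fintype.card (Y n) : ℝ)) →
      Filter.Tendsto (fun n => HolevoHash.avgError E δ (F n)) Filter.atTop (nhds 0)) := by
  open scoped MatrixOrder in
  refine ⟨fun n Y _ f => ⟨fun y => Matrix.nonneg_iff_posSemidef.mp
      (HolevoHash.prettyGoodMeasurement_nonneg (E.Λ_nonneg δ) f y), fun h =>
      Matrix.le_iff.mp (HolevoHash.sum_prettyGoodMeasurement_le_one (E.Λ_nonneg δ) f h)⟩,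
    fun ε hε => ?_, fun Y K _ _ _ F hF hY => HolevoHash.tendsto_avgError E hδ hF hY⟩
  obtain ⟨N, hN⟩ := Filter.eventually_atTop.mp
    ((E.tendsto_missError hδ).eventually_le_const (by positivity : 0 < 4 * ε))
  refine ⟨N, fun n hn Y K _ _ _ F hF => (HolevoHash.avgError_le E δ hF).trans ?_⟩
  linarith [hN n hn]
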